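/- Graphs are finite and simple. For a graph $G$ with vertex set $V(G)$ and $T\subseteq V(G)$, let $c_G(T)$ be the number of connected components of the induced subgraph $G_{V(G)\setminus T}$. The set $T$ has the cut point property for $G$ if every $i\in T$ is a cut point of $G_{(V(G)\setminus T)\cup\{i\}}$, i.e. deleting $i$ from this graph increases the number of connected components. Let $\mathcal C(G)$ consist of $\emptyset$ and all sets $T\subseteq V(G)$ with the cut point property for $G$. Let $K$ be a field and $S_G=K[x_i,y_i : i\in V(G)]$. The binomial edge ideal $J_G\subseteq S_G$ is generated by the binomials $x_iy_j-x_jy_i$ with $\{i,j\}\in E(G)$. For $T\subseteq V(G)$, let $$P_T(G)=\Big(\bigcup_{i\in T}\{x_i,y_i\},\,J_{\widetilde G_1},\ldots,J_{\widetilde G_{c_G(T)}}\Big)\subseteq S_G,$$ where $G_1,\ldots,G_{c_G(T)}$ are the connected components of $G_{V(G)\setminus T}$ and $\widetilde G_k$ is the complete graph on $V(G_k)$. Let $H$ and $H'$ be connected graphs with $n_1\ge 1$ and $n_2\ge 1$ vertices, respectively. Their corona $H\odot H'$ is obtained from one copy of $H$ and, for each $v\in V(H)$, a copy $H'_v$ of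 $H'$, by joining $v$ to every vertex of $H'_v$. Say that a set $T$ and sets $T_v$ ($v\in T$) satisfy property $\mathcal P$ if $\emptyset\ne T\subseteq V(H)$, $T_v\in\mathcal C(H'_v)$ for all $v\in T$, and $T_v\neq\emptyset$ whenever $v\in T$ and the set $N_H(v)$ of neighbors of $v$ in $H$ is contained in $T$. **Proposition 5.1.** With this notation: (a) $\mathcal C(H\odot H')=\{\emptyset\}\cup\big\{T\cup\bigcup_{v\in T}T_v : T,\ (T_v)_{v\in T}\text{ satisfy }\mathcal P\big\}.$ (b) $\operatorname{height} J_{H\odot H'}$ is the minimum of the set consisting of the number $n_1+n_1n_2-1$ and all the numbers $$\operatorname{height}P_T(H)+\sum_{v\in T}\operatorname{height}P_{T_v}(H'_v)+n_2(n_1-|T|),$$ where $T,(T_v)_{v\in T}$ satisfy $\mathcal P$. (c) $\dim S_{H\odot H'}/J_{H\odot H'}$ is the maximum of the set consisting of the number $n_1+n_1n_2+1$ and all the numbers $$\dim S_H/P_T(H)+\sum_{v\in T}\dim S_{H'_v}/P_{T_v}(H'_v)+n_2(n_1-|T|),$$ where $T,(T_v)_{v\in T}$ satisfy $\mathcal P$.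 -/

import Mathlib

namespace SimpleGraph

universe u v w

/-- The polynomial ring `K[x_i, y_i : i ∈ V]`; the variable `x_i` is indexed by `Sum.inl i` and
`y_i` by `Sum.inr i`. -/
abbrev EdgeRing (V : Type u) (K : Type w) [Field K] : Type (max u w) := MvPolynomial (V ⊕ V) K

/-- The variable `x_i`. -/
noncomputable def xVar {V : Type u} (K : Type w) [Field K] (i : V) : EdgeRing V K :=
  MvPolynomial.X (Sum.inl i)

/-- The variable `y_i`. -/
noncomputable def yVar {V : Type u} (K : Type w) [Field K] (i : V) : EdgeRing V K :=
  MvPolynomial.X (Sum.inr i)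

/-- The binomial edge ideal `J_G`, generated by `f_{ij} = x_i y_j - x_j y_i` for the edges
`{i, j}` of `G`. (Both orientations of an edge are listed; since `f_{ji} = - f_{ij}`, this is the
same ideal as with one generator for each edge, and no order on the vertices is needed.) -/
noncomputable def binomialEdgeIdeal {V : Type u} (G : SimpleGraph V) (K : Type w) [Field K] :
    Ideal (EdgeRing V K) :=
  Ideal.span {f | ∃ i j : V, G.Adj i j ∧ f = xVar K i * yVar K j - xVar K j * yVar K i}

/-- The complete graph on the vertex subset `A` (vertices outside `A` are isolated, so they
contribute nothing to the binomial edge ideal). -/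
def completeOn {V : Type u} (A : Set V) : SimpleGraph V where
  Adj i j := i ∈ A ∧ j ∈ A ∧ i ≠ j
  symm := ⟨fun _ _ h => ⟨h.2.1, h.1, h.2.2.symm⟩⟩
  loopless := ⟨fun _ h => h.2.2 rfl⟩

/-- The ideal `P_T(G)`, generated by the variables `x_i, y_i` for `i ∈ T` and by the binomial edge
ideals of the complete graphs on the vertex sets of the connected components of the induced
subgraph of `G` on the complement of `T`. -/
noncomputable def primeIdealOf {V : Type u} (G : SimpleGraph V) (K : Type w) [Field K]
    (T : Finset V) : Ideal (EdgeRing V K) :=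
  Ideal.span (⋃ i ∈ T, {xVar K i, yVar K i}) ⊔
    ⨆ C : (G.induce ((T : Set V)ᶜ)).ConnectedComponent,
      (completeOn (Subtype.val '' C.supp)).binomialEdgeIdeal K

/-- `v` is a cut point of the (finite) graph `G`: deleting `v` gives a graph with more connected
components than `G`. -/
def IsCutPoint {V : Type u} (G : SimpleGraph V) (v : V) : Prop :=
  Nat.card G.ConnectedComponent < Nat.card (G.induce ({v}ᶜ : Set V)).ConnectedComponent

/-- `T` has the cut point property for `G`: each `i ∈ T` is a cut point of the induced subgraph of
`G` on `(V \ T) ∪ {i}`. -/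
def HasCutPointProperty {V : Type u} (G : SimpleGraph V) (T : Finset V) : Prop :=
  ∀ i ∈ T, (G.induce ((T : Set V)ᶜ ∪ {i})).IsCutPoint ⟨i, Or.inr rfl⟩

/-- The family `C(G)` of the empty set and all vertex sets with the cut point property. -/
def cutPointSets {V : Type u} (G : SimpleGraph V) : Set (Finset V) :=
  {∅} ∪ {T | G.HasCutPointProperty T}

/-- The corona `H ⊙ H'`: one copy of `H` (vertices `Sum.inl v`) and, for each vertex `v` of `H`,
a copy `H'_v` of `H'` (vertices `Sum.inr (v, a)`) all of whose vertices are joined to `v`. -/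
def corona {V : Type u} {W : Type v} (H : SimpleGraph V) (H' : SimpleGraph W) :
    SimpleGraph (V ⊕ V × W) where
  Adj
    | Sum.inl s, Sum.inl t => H.Adj s t
    | Sum.inl s, Sum.inr q => s = q.1
    | Sum.inr p, Sum.inl t => p.1 = t
    | Sum.inr p, Sum.inr q => p.1 = q.1 ∧ H'.Adj p.2 q.2
  symm := ⟨by
    rintro (s | p) (t | q) h
    · exact H.adj_symm h
    · exact Eq.symm h
    · exact Eq.symm h
    · exact ⟨h.1.symm, H'.adj_symm h.2⟩⟩
  loopless := ⟨by
    rintro (s | p) h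
    · exact H.irrefl h
    · exact H'.irrefl h.2⟩

/-- The property of `T` and `T_v`, `v ∈ T`: `T` is a nonempty set of vertices of `H`, each `T_v` is
in `C(H'_v)`, and `T_v ≠ ∅` if `N_H(v) ⊆ T`. A set of vertices of the copy `H'_v` is given as a set
of vertices of `H'`; the values of the family `Tv` outside `T` play no role. -/
def CoronaProperty {V : Type u} {W : Type v} (H : SimpleGraph V) (H' : SimpleGraph W)
    (T : Finset V) (Tv : V → Finset W) : Prop :=
  T.Nonempty ∧ ∀ v ∈ T, Tv v ∈ H'.cutPointSets ∧ (H.neighborSet v ⊆ (T : Set V) → Tv v ≠ ∅)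

/-- The set `T ∪ ⋃_{v ∈ T} T_v` of vertices of the corona, where `T_v` is placed in the copy
indexed by `v`. -/
def coronaSet {V : Type u} {W : Type v} [DecidableEq V] [DecidableEq W]
    (T : Finset V) (Tv : V → Finset W) : Finset (V ⊕ V × W) :=
  T.image Sum.inl ∪ T.biUnion fun v => (Tv v).image fun a => Sum.inr (v, a)

end SimpleGraph

/-! The ideal `P_T(G)` and the prime ideal of the matrices whose columns have prescribed directions
(zero for the vertices in `T`, one common direction for each component of the complement) have the
same zero locus. Specialising the directions, or making them more general, one step at a time lowers
or raises the dimension count by at most one. This gives chains of primes upwards and downwards from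
each such prime whose lengths add up to the dimension of the polynomial ring, so that both the
height and the dimension are read off from the count. Every prime ideal containing `J_G` contains
some `P_T(G)`, and `T` can be shrunk until each of its vertices is a cut point; hence the height and
the dimension of `J_G` are extremal values over `C(G)`. For the corona, a nonempty set with the cut
point property meets `H`, since the neighbors of a vertex in a copy of `H'` are connected through
the vertex of `H` to which the copy is joined, and the components left by deleting
`T ∪ ⋃_{v ∈ T} T_v` are those of `H - T` and those of the `H'_v - T_v`. -/

namespace BinomialEdge

open Order PrimeSpectrum

theorem natCast_le_coheight {α ι : Type*} [Preorder α] {f : ι → α} {d : ι → ℕ}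
    (h : ∀ i, 0 < d i → ∃ j, f i < f j ∧ d i ≤ d j + 1) (i : ι) : (d i : ℕ∞) ≤ coheight (f i) := by
  suffices H : ∀ m i, m ≤ d i → (m : ℕ∞) ≤ coheight (f i) from H _ i le_rfl
  intro m
  induction m with
  | zero => simp
  | succ m ih =>
    intro i hm
    obtain ⟨j, hij, hd⟩ := h i (by omega)
    calc ((m + 1 : ℕ) : ℕ∞) = m + 1 := by push_cast; rfl
      _ ≤ coheight (f j) + 1 := by gcongr; exact ih j (by omega)
      _ ≤ coheight (f i) := coheight_add_one_le hij

theorem height_add_coheight_le_krullDim {α : Type*} [Preorder α] (a : α) :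
    ((height a + coheight a : ℕ∞) : WithBot ℕ∞) ≤ krullDim α := by
  have : Nonempty α := ⟨a⟩
  rw [krullDim_eq_iSup_height_add_coheight_of_nonempty, WithBot.coe_le_coe]
  exact le_iSup (fun b : α => height b + coheight b) a

theorem height_eq_and_coheight_eq {α ι : Type*} [Preorder α] {f : ι → α} {d : ι → ℕ} {n : ℕ}
    (hα : krullDim α = n) (hup : ∀ i, 0 < d i → ∃ j, f i < f j ∧ d i ≤ d j + 1)
    (hdown : ∀ i, d i < n → ∃ j, f j < f i ∧ d j ≤ d i + 1) (i : ι) :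
    height (f i) = (n - d i : ℕ) ∧ coheight (f i) = d i := by
  have hco : (d i : ℕ∞) ≤ coheight (f i) := natCast_le_coheight hup i
  have hht : ((n - d i : ℕ) : ℕ∞) ≤ height (f i) := by
    refine natCast_le_coheight (f := fun i => OrderDual.toDual (f i)) (d := fun i => n - d i)
      (fun i hi => ?_) i
    obtain ⟨j, hj, hd⟩ := hdown i (by omega)
    exact ⟨j, hj, by omega⟩
  have hsum : height (f i) + coheight (f i) ≤ n := by
    exact_mod_cast hα ▸ height_add_coheight_le_krullDim (f i)
  obtain ⟨a, ha⟩ := ENat.ne_top_iff_exists.1 (ne_top_of_le_ne_top (ENat.natCast_ne_top n)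
    (le_self_add.trans hsum))
  obtain ⟨b, hb⟩ := ENat.ne_top_iff_exists.1 (ne_top_of_le_ne_top (ENat.natCast_ne_top n)
    (le_add_self.trans hsum))
  rw [← ha] at hht hsum ⊢
  rw [← hb] at hco hsum ⊢
  have hsum : a + b ≤ n := by exact_mod_cast hsum
  have hda : n - d i ≤ a := Nat.cast_le.1 hht
  have hdb : d i ≤ b := Nat.cast_le.1 hco
  exact ⟨by congr 1; omega, by congr 1; omega⟩

section ZeroLocus

variable {R : Type*} [CommRing R]

theorem ringKrullDim_quotient_asIdeal (p : PrimeSpectrum R) :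
    ringKrullDim (R ⧸ p.asIdeal) = coheight p := by
  rw [ringKrullDim_quotient, coheight_eq_krullDim_Ici]
  rfl

theorem height_le_height_of_zeroLocus_subset {I J : Ideal R}
    (h : zeroLocus (J : Set R) ⊆ zeroLocus I) : I.height ≤ J.height := by
  rw [J.height_eq_inf_minimalPrimes]
  exact le_iInf₂ fun Q hQ => Ideal.height_mono (@h ⟨Q, hQ.1.1⟩ hQ.1.2)

theorem ringKrullDim_quotient_le_of_zeroLocus_subset {I J : Ideal R}
    (h : zeroLocus (J : Set R) ⊆ zeroLocus I) : ringKrullDim (R ⧸ J) ≤ ringKrullDim (R ⧸ I) := by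
  rw [ringKrullDim_quotient, ringKrullDim_quotient]
  exact krullDim_le_of_strictMono (Set.inclusion h) fun _ _ hpq => hpq

theorem ringKrullDim_quotient_le_of_forall_mem_zeroLocus {I : Ideal R} {n : WithBot ℕ∞}
    (h : ∀ p ∈ zeroLocus (I : Set R), ringKrullDim (R ⧸ p.asIdeal) ≤ n) :
    ringKrullDim (R ⧸ I) ≤ n := by
  rw [ringKrullDim_quotient, krullDim_eq_iSup_coheight]
  refine iSup_le fun p => le_trans ?_ (h p p.2)
  rw [ringKrullDim_quotient_asIdeal, WithBot.coe_le_coe]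
  exact coheight_le_coheight_apply_of_strictMono Subtype.val (fun _ _ hpq => hpq) p

variable {ι : Type*} {I : Ideal R} {P : ι → Ideal R} {s : Set ι}

theorem isLeast_height_of_zeroLocus_eq_biUnion (hs : s.Nonempty)
    (h : zeroLocus (I : Set R) = ⋃ t ∈ s, zeroLocus (P t : Set R)) :
    IsLeast ((fun t => (P t).height) '' s) I.height := by
  have hle : ∀ t ∈ s, I.height ≤ (P t).height := fun t ht =>
    height_le_height_of_zeroLocus_subset
      (h ▸ Set.subset_biUnion_of_mem (u := fun t => zeroLocus (P t : Set R)) ht)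
  obtain ⟨t, ht, hmin⟩ := exists_minimalFor_of_wellFoundedLT (· ∈ s) (fun t => (P t).height) hs
  refine ⟨⟨t, ht, le_antisymm ?_ (hle t ht)⟩, Set.forall_mem_image.2 hle⟩
  rw [I.height_eq_inf_minimalPrimes]
  refine le_iInf₂ fun Q hQ => ?_
  have hQI : ⟨Q, hQ.1.1⟩ ∈ zeroLocus (I : Set R) := hQ.1.2
  obtain ⟨r, hr, hrQ⟩ := Set.mem_iUnion₂.1 (h.subset hQI)
  exact ((le_total _ _).elim id (hmin hr)).trans (Ideal.height_mono hrQ)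

theorem isGreatest_ringKrullDim_of_zeroLocus_eq_biUnion (hs : s.Nonempty) (hfin : s.Finite)
    (h : zeroLocus (I : Set R) = ⋃ t ∈ s, zeroLocus (P t : Set R)) :
    IsGreatest ((fun t => ringKrullDim (R ⧸ P t)) '' s) (ringKrullDim (R ⧸ I)) := by
  have hle : ∀ t ∈ s, ringKrullDim (R ⧸ P t) ≤ ringKrullDim (R ⧸ I) := fun t ht =>
    ringKrullDim_quotient_le_of_zeroLocus_subset
      (h ▸ Set.subset_biUnion_of_mem (u := fun t => zeroLocus (P t : Set R)) ht)
  obtain ⟨t, ht, hmax⟩ := Set.exists_max_image s (fun t => ringKrullDim (R ⧸ P t)) hfin hs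
  refine ⟨⟨t, ht, le_antisymm (hle t ht) ?_⟩, Set.forall_mem_image.2 hle⟩
  refine ringKrullDim_quotient_le_of_forall_mem_zeroLocus fun p hp => ?_
  obtain ⟨r, hr, hrp⟩ := Set.mem_iUnion₂.1 (h.subset hp)
  exact (ringKrullDim_quotient_le_of_zeroLocus_subset
    (zeroLocus_anti_mono hrp)).trans (hmax r hr)

end ZeroLocus

/-- The direction of a column `(x_i, y_i)` of a `2 × V` matrix: the zero vector, the horizontal axis
`(1, 0)`, or the generic vector `(u_k, w_k)` with index `k`. Specialising directions produces the
chains of prime ideals that give heights and dimensions. -/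
inductive Direction (ι : Type*) where
  | zero : Direction ι
  | horizontal : Direction ι
  | generic (k : ι) : Direction ι

namespace Direction

variable {ι R : Type*} [CommRing R]

/-- The first coordinate of a direction, given the first coordinates `u_k` of the generic ones. -/
def xCoord (u : ι → R) : Direction ι → R
  | zero => 0
  | horizontal => 1
  | generic k => u k

/-- The second coordinate of a direction, given the second coordinates `w_k` of the generic ones. -/
def yCoord (w : ι → R) : Direction ι → R
  | zero => 0
  | horizontal => 0
  | generic k => w k

end Direction

section ColumnPrime

open SimpleGraph Direction

variable {V ι : Type*} (K : Type*) [Field K]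

/-- The binomial `x_i y_j - x_j y_i`, a maximal minor of the generic `2 × V` matrix. -/
noncomputable def minor (i j : V) : EdgeRing V K :=
  xVar K i * yVar K j - xVar K j * yVar K i

/-- The parametrization `(x_i, y_i) = t_i • c i` of the matrices whose `i`-th column has the
direction `c i`. The parameters `t_i`, `u_k` and `w_k` are the variables indexed by the three
summands of `V ⊕ ι ⊕ ι`. -/
noncomputable def param (c : V → Direction ι) :
    EdgeRing V K →ₐ[K] MvPolynomial (V ⊕ ι ⊕ ι) K :=
  MvPolynomial.aeval (Sum.elim
    (fun i => .X (.inl i) * (c i).xCoord fun k => .X (.inr (.inl k)))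
    (fun i => .X (.inl i) * (c i).yCoord fun k => .X (.inr (.inr k))))

/-- The prime ideal of the closure of the set of matrices whose `i`-th column has the direction
`c i`. -/
noncomputable def columnPrime (c : V → Direction ι) : Ideal (EdgeRing V K) :=
  RingHom.ker (param K c)

instance (c : V → Direction ι) : (columnPrime K c).IsPrime := RingHom.ker_isPrime _

variable {K}

@[simp] theorem param_xVar (c : V → Direction ι) (i : V) :
    param K c (xVar K i) = .X (.inl i) * (c i).xCoord fun k => .X (.inr (.inl k)) := by
  simp [param, xVar]

@[simp] theorem param_yVar (c : V → Direction ι) (i : V) :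
    param K c (yVar K i) = .X (.inl i) * (c i).yCoord fun k => .X (.inr (.inr k)) := by
  simp [param, yVar]

theorem xVar_mem_columnPrime {c : V → Direction ι} {i : V} :
    xVar K i ∈ columnPrime K c ↔ c i = zero := by
  rw [columnPrime, RingHom.mem_ker, param_xVar]
  cases c i <;> simp [xCoord]

theorem yVar_mem_columnPrime {c : V → Direction ι} {i : V} :
    yVar K i ∈ columnPrime K c ↔ ∀ k, c i ≠ generic k := by
  rw [columnPrime, RingHom.mem_ker, param_yVar]
  cases c i <;> simp [yCoord]

theorem minor_mem_columnPrime {c : V → Direction ι} {i j : V} (h : c i = c j) :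
    minor K i j ∈ columnPrime K c := by
  simp only [minor, columnPrime, RingHom.mem_ker, map_sub, map_mul, param_xVar, param_yVar, h]
  ring

theorem minor_notMem_columnPrime {c : V → Direction ι} {i j : V} {k l : ι} (hi : c i = generic k)
    (hj : c j = generic l) (hkl : k ≠ l) : minor K i j ∉ columnPrime K c := by
  classical
  intro h
  simp only [minor, columnPrime, RingHom.mem_ker, map_sub, map_mul, param_xVar, param_yVar, xCoord,
    yCoord, hi, hj] at h
  have := congrArg (MvPolynomial.aeval (R := K)
    (Sum.elim (fun _ => (1 : K)) (Sum.elim (Pi.single k 1) (Pi.single l 1)))) h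
  simp [hkl, hkl.symm] at this

theorem exists_common_direction {L α : Type*} [Field L] {s : Set α} {a b : α → L}
    (h : ∀ i ∈ s, ∀ j ∈ s, a i * b j = a j * b i) :
    ∃ u w, ∀ i ∈ s, ∃ t, a i = t * u ∧ b i = t * w := by
  by_cases h0 : ∃ i ∈ s, a i ≠ 0 ∨ b i ≠ 0
  · obtain ⟨i, hi, ha | hb⟩ := h0
    · refine ⟨a i, b i, fun j hj => ⟨a j / a i, by field_simp, ?_⟩⟩
      field_simp
      linear_combination h i hi j hj
    · refine ⟨a i, b i, fun j hj => ⟨b j / b i, ?_, by field_simp⟩⟩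
      field_simp
      linear_combination h j hj i hi
  · push Not at h0
    exact ⟨0, 0, fun i hi => ⟨0, by simp [h0 i hi]⟩⟩

theorem columnPrime_le {c : V → Direction ι} {Q : Ideal (EdgeRing V K)} [Q.IsPrime]
    (hx : ∀ i, c i = zero → xVar K i ∈ Q) (hy : ∀ i, (∀ k, c i ≠ generic k) → yVar K i ∈ Q)
    (hminor : ∀ i j k, c i = generic k → c j = generic k → minor K i j ∈ Q) :
    columnPrime K c ≤ Q := by
  -- The point of the variety of `Q` over its residue field lies in the image of `param`.
  let π := IsScalarTower.toAlgHom K (EdgeRing V K) Q.ResidueField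
  have hπ (f) : π f = 0 ↔ f ∈ Q := Ideal.algebraMap_residueField_eq_zero
  have hdir (k : ι) : ∃ u w, ∀ i ∈ {i | c i = generic k}, ∃ t,
      π (xVar K i) = t * u ∧ π (yVar K i) = t * w :=
    exists_common_direction fun i hi j hj => by
      simpa [minor, sub_eq_zero] using (hπ _).2 (hminor i j k hi hj)
  choose u w hdir using hdir
  have hcol (i : V) : ∃ t, t * (c i).xCoord u = π (xVar K i) ∧
      t * (c i).yCoord w = π (yVar K i) := by
    cases hc : c i with
    | zero => exact ⟨0, by simp [(hπ _).2 (hx i hc), (hπ _).2 (hy i (by simp [hc]))]⟩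
    | horizontal => exact ⟨π (xVar K i), by simp [xCoord, yCoord, (hπ _).2 (hy i (by simp [hc]))]⟩
    | generic k => exact (hdir k i hc).imp fun t ht => ⟨ht.1.symm, ht.2.symm⟩
  choose t htx hty using hcol
  let ψ : MvPolynomial (V ⊕ ι ⊕ ι) K →ₐ[K] Q.ResidueField :=
    MvPolynomial.aeval (Sum.elim t (Sum.elim u w))
  have hψx (d : Direction ι) : ψ (d.xCoord fun k => .X (.inr (.inl k))) = d.xCoord u := by
    cases d <;> simp [xCoord, ψ]
  have hψy (d : Direction ι) : ψ (d.yCoord fun k => .X (.inr (.inr k))) = d.yCoord w := by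
    cases d <;> simp [yCoord, ψ]
  have hfactor : ψ.comp (param K c) = π := by
    apply MvPolynomial.algHom_ext
    rintro (i | i)
    · change ψ (param K c (xVar K i)) = π (xVar K i)
      rw [param_xVar, map_mul, hψx, ← htx]
      simp [ψ]
    · change ψ (param K c (yVar K i)) = π (yVar K i)
      rw [param_yVar, map_mul, hψy, ← hty]
      simp [ψ]
  intro f hf
  rw [← hπ, ← hfactor, AlgHom.comp_apply, RingHom.mem_ker.1 hf, map_zero]

theorem columnPrime_le_columnPrime {κ : Type*} {c : V → Direction ι} {c' : V → Direction κ}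
    (hzero : ∀ i, c i = zero → c' i = zero)
    (hhorizontal : ∀ i, c i = horizontal → ∀ k, c' i ≠ generic k)
    (hgeneric : ∀ i j k, c i = generic k → c j = generic k → c' i = c' j) :
    columnPrime K c ≤ columnPrime K c' := by
  refine columnPrime_le (fun i hi => xVar_mem_columnPrime.2 (hzero i hi))
    (fun i hi => yVar_mem_columnPrime.2 ?_)
    (fun i j k hi hj => minor_mem_columnPrime (hgeneric i j k hi hj))
  cases hc : c i with
  | zero => simp [hzero i hc]
  | horizontal => exact hhorizontal i hc
  | generic k => exact absurd hc (hi k)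

theorem columnPrime_lt_update_zero [DecidableEq V] {c : V → Direction ι} {i : V}
    (hi : c i = horizontal) : columnPrime K c < columnPrime K (Function.update c i zero) := by
  refine lt_of_le_not_ge (columnPrime_le_columnPrime ?_ ?_ ?_) fun hge => ?_
  · intro j hj
    by_cases hji : j = i <;> simp_all
  · intro j hj
    by_cases hji : j = i <;> simp_all
  · intro j l k hj hl
    have hji : j ≠ i := by rintro rfl; simp_all
    have hli : l ≠ i := by rintro rfl; simp_all
    simp [hji, hli, hj, hl]
  · have := hge (xVar_mem_columnPrime.2 (Function.update_self i zero c))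
    simp [xVar_mem_columnPrime, hi] at this

/-- The directions obtained from `c` by specialising the generic direction `k` to `d`. -/
def specialize [DecidableEq (Direction ι)] (c : V → Direction ι) (k : ι) (d : Direction ι) :
    V → Direction ι :=
  Function.update id (generic k) d ∘ c

theorem columnPrime_lt_specialize [DecidableEq (Direction ι)] {c : V → Direction ι} {k : ι}
    {d : Direction ι} (hk : generic k ∈ Set.range c) (hdk : d ≠ generic k)
    (hd : d = horizontal ∨ d ∈ Set.range c) :
    columnPrime K c < columnPrime K (specialize c k d) := by
  obtain ⟨i, hi⟩ := hk
  have hi' : specialize c k d i = d := by simp [specialize, hi]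
  refine lt_of_le_not_ge (columnPrime_le_columnPrime ?_ ?_ ?_) fun hge => ?_
  · intro j hj
    simp [specialize, hj]
  · intro j hj
    simp [specialize, hj]
  · intro j l m hj hl
    simp [specialize, hj, hl]
  · have hy : (∀ l, d ≠ generic l) → False := fun h =>
      yVar_mem_columnPrime.1 (hge (yVar_mem_columnPrime.2 (by rwa [hi']))) k hi
    obtain rfl | ⟨j, hj⟩ := hd
    · exact hy (by simp)
    · cases hdl : d with
      | zero => exact hy (by simp [hdl])
      | horizontal => exact hy (by simp [hdl])
      | generic l =>
        have hj' : specialize c k d j = d := by simp [specialize, hj, hdk]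
        exact minor_notMem_columnPrime hi (hj.trans hdl) (by rintro rfl; exact hdk hdl)
          (hge (minor_mem_columnPrime (hi'.trans hj'.symm)))

/-- The dimension of the variety of `columnPrime K c`: a scalar for each nonzero column, and a point
of the projective line for each generic direction that occurs. -/
noncomputable def columnDim (c : V → Direction ι) : ℕ :=
  {i | c i ≠ zero}.ncard + (generic ⁻¹' Set.range c).ncard

theorem exists_generic_notMem_range {c : V → Direction V} (hz : ∀ i, c i ≠ zero)
    (h : columnDim c < 2 * Nat.card V) : ∃ l, generic l ∉ Set.range c := by
  by_contra! hall
  have hsupport : {i | c i ≠ zero} = Set.univ := Set.eq_univ_of_forall hz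
  have hgeneric : generic ⁻¹' Set.range c = Set.univ := Set.eq_univ_of_forall hall
  rw [columnDim, hsupport, hgeneric, Set.ncard_univ] at h
  omega

variable [Finite V]

theorem finite_generic_preimage_range (c : V → Direction ι) :
    (generic ⁻¹' Set.range c).Finite :=
  (Set.finite_range c).preimage fun _ _ _ _ h => by injection h

theorem columnDim_le_columnDim_update_zero [DecidableEq V] {c : V → Direction ι} {i : V}
    (hi : c i = horizontal) : columnDim c ≤ columnDim (Function.update c i zero) + 1 := by
  have hsupport : {j | c j ≠ zero} ⊆ insert i {j | Function.update c i zero j ≠ zero} := by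
    intro j hj
    by_cases hji : j = i <;> simp_all
  have hgeneric : generic ⁻¹' Set.range c ⊆ generic ⁻¹' Set.range (Function.update c i zero) := by
    rintro k ⟨j, hj⟩
    exact ⟨j, by rw [Function.update_of_ne (by rintro rfl; simp_all), hj]⟩
  have h₁ := (Set.ncard_le_ncard hsupport (Set.toFinite _)).trans (Set.ncard_insert_le _ _)
  have h₂ := Set.ncard_le_ncard hgeneric (finite_generic_preimage_range _)
  unfold columnDim
  omega

theorem columnDim_le_columnDim_specialize [DecidableEq (Direction ι)] {c : V → Direction ι} {k : ι}
    {d : Direction ι} (hd : d ≠ zero) : columnDim c ≤ columnDim (specialize c k d) + 1 := by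
  have hsupport : {j | c j ≠ zero} ⊆ {j | specialize c k d j ≠ zero} := by
    intro j hj
    by_cases hjk : c j = generic k <;> simp_all [specialize]
  have hgeneric : generic ⁻¹' Set.range c ⊆
      insert k (generic ⁻¹' Set.range (specialize c k d)) := by
    rintro l ⟨j, hj⟩
    by_cases hlk : l = k
    · exact Or.inl hlk
    · exact Or.inr ⟨j, by simp [specialize, hj, hlk]⟩
  have h₁ := Set.ncard_le_ncard hsupport (Set.toFinite _)
  have h₂ := (Set.ncard_le_ncard hgeneric ((finite_generic_preimage_range _).insert k)).trans
    (Set.ncard_insert_le _ _)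
  unfold columnDim
  omega

theorem exists_columnPrime_gt {c : V → Direction ι} (h : 0 < columnDim c) :
    ∃ c' : V → Direction ι, columnPrime K c < columnPrime K c' ∧
      columnDim c ≤ columnDim c' + 1 := by
  classical
  by_cases hk : ∃ k, generic k ∈ Set.range c
  · obtain ⟨k, hk⟩ := hk
    exact ⟨specialize c k horizontal, columnPrime_lt_specialize hk (by simp) (Or.inl rfl),
      columnDim_le_columnDim_specialize (by simp)⟩
  · push Not at hk
    have hempty : generic ⁻¹' Set.range c = ∅ := Set.eq_empty_of_forall_notMem hk
    obtain ⟨i, hi⟩ : {i | c i ≠ zero}.Nonempty := by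
      rw [← Set.ncard_pos]
      simpa [columnDim, hempty] using h
    have hi : c i = horizontal := by
      cases hc : c i with
      | zero => exact absurd hc hi
      | horizontal => rfl
      | generic k => exact absurd ⟨i, hc⟩ (hk k)
    exact ⟨_, columnPrime_lt_update_zero hi, columnDim_le_columnDim_update_zero hi⟩

theorem exists_horizontal_or_repeated {c : V → Direction V} (hz : ∀ i, c i ≠ zero) {l : V}
    (hl : generic l ∉ Set.range c) : ∃ i, c i = horizontal ∨ ∃ j ≠ i, c j = c i := by
  by_contra! hc
  have hgen (i : V) : ∃ k, c i = generic k := by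
    cases hci : c i with
    | zero => exact absurd hci (hz i)
    | horizontal => exact absurd hci (hc i).1
    | generic k => exact ⟨k, rfl⟩
  choose g hg using hgen
  have hinj : g.Injective := fun i j hij => by
    by_contra hne
    exact (hc j).2 i hne (by rw [hg, hg, hij])
  obtain ⟨i, rfl⟩ := Finite.surjective_of_injective hinj l
  exact hl ⟨i, hg i⟩

theorem exists_columnPrime_lt {c : V → Direction V} (h : columnDim c < 2 * Nat.card V) :
    ∃ c' : V → Direction V, columnPrime K c' < columnPrime K c ∧
      columnDim c' ≤ columnDim c + 1 := by
  classical
  by_cases hz : ∃ i, c i = zero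
  · obtain ⟨i, hi⟩ := hz
    have hc : Function.update (Function.update c i horizontal) i zero = c := by
      rw [Function.update_idem, ← hi, Function.update_eq_self]
    have hi' : Function.update c i horizontal i = horizontal := Function.update_self ..
    have hlt := columnPrime_lt_update_zero (K := K) hi'
    have hdim := columnDim_le_columnDim_update_zero hi'
    rw [hc] at hlt hdim
    exact ⟨_, hlt, hdim⟩
  · push Not at hz
    obtain ⟨l, hl⟩ := exists_generic_notMem_range hz h
    obtain ⟨i, hi⟩ := exists_horizontal_or_repeated hz hl
    set c' := Function.update c i (generic l) with hc'
    have hc : specialize c' l (c i) = c := by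
      ext1 j
      by_cases hji : j = i
      · simp [hc', hji, specialize]
      · have hj : c j ≠ generic l := fun hj => hl ⟨j, hj⟩
        simp [hc', hji, specialize, Function.update_of_ne hj]
    have hi' : c i = horizontal ∨ c i ∈ Set.range c' := hi.imp_right fun ⟨j, hji, hj⟩ =>
      ⟨j, by rw [hc', Function.update_of_ne hji, hj]⟩
    have hlt := columnPrime_lt_specialize (K := K) (c := c') ⟨i, Function.update_self ..⟩
      (fun hci => hl ⟨i, hci⟩) hi'
    have hdim := columnDim_le_columnDim_specialize (c := c') (k := l) (hz i)
    rw [hc] at hlt hdim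
    exact ⟨c', hlt, hdim⟩

theorem ringKrullDim_edgeRing : ringKrullDim (EdgeRing V K) = (2 * Nat.card V : ℕ) := by
  simp [EdgeRing, two_mul]

theorem height_and_ringKrullDim_columnPrime (c : V → Direction V) :
    (columnPrime K c).height = (2 * Nat.card V - columnDim c : ℕ) ∧
      ringKrullDim (EdgeRing V K ⧸ columnPrime K c) = columnDim c := by
  let point (c : V → Direction V) : PrimeSpectrum (EdgeRing V K) := ⟨columnPrime K c, inferInstance⟩
  obtain ⟨hheight, hcoheight⟩ := height_eq_and_coheight_eq (f := point) ringKrullDim_edgeRing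
    (fun _ => exists_columnPrime_gt) (fun _ => exists_columnPrime_lt) c
  constructor
  · rw [← hheight, ← PrimeSpectrum.height_eq_orderHeight]
  · rw [ringKrullDim_quotient_asIdeal (point c), hcoheight]
    rfl

end ColumnPrime

section PrimeIdealOf

open SimpleGraph Direction

variable {V K : Type*} [Field K] {G : SimpleGraph V} {T : Finset V} {Q : Ideal (EdgeRing V K)}

theorem xVar_mem_primeIdealOf {i : V} (hi : i ∈ T) : xVar K i ∈ G.primeIdealOf K T :=
  Ideal.mem_sup_left (Ideal.subset_span (Set.mem_biUnion hi (Or.inl rfl)))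

theorem yVar_mem_primeIdealOf {i : V} (hi : i ∈ T) : yVar K i ∈ G.primeIdealOf K T :=
  Ideal.mem_sup_left (Ideal.subset_span (Set.mem_biUnion hi (Or.inr rfl)))

theorem minor_mem_of_xVar_mem_of_yVar_mem {i : V} (j : V) (hx : xVar K i ∈ Q) (hy : yVar K i ∈ Q) :
    minor K i j ∈ Q ∧ minor K j i ∈ Q :=
  ⟨sub_mem (Ideal.mul_mem_right _ _ hx) (Ideal.mul_mem_left _ _ hy),
    sub_mem (Ideal.mul_mem_left _ _ hy) (Ideal.mul_mem_right _ _ hx)⟩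

theorem minor_mem_primeIdealOf {i j : ((T : Set V)ᶜ : Set V)}
    (h : (G.induce (T : Set V)ᶜ).Reachable i j) : minor K i.1 j.1 ∈ G.primeIdealOf K T := by
  by_cases hij : i.1 = j.1
  · simp [minor, hij]
  · refine Ideal.mem_sup_right (Ideal.mem_iSup_of_mem (connectedComponentMk _ i) ?_)
    exact Ideal.subset_span
      ⟨i, j, ⟨⟨i, rfl, rfl⟩, ⟨j, ConnectedComponent.sound h.symm, rfl⟩, hij⟩, rfl⟩

theorem primeIdealOf_le_iff : G.primeIdealOf K T ≤ Q ↔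
    (∀ i ∈ T, xVar K i ∈ Q ∧ yVar K i ∈ Q) ∧ ∀ i j : ((T : Set V)ᶜ : Set V),
      (G.induce (T : Set V)ᶜ).Reachable i j → minor K i.1 j.1 ∈ Q := by
  constructor
  · exact fun h => ⟨fun i hi => ⟨h (xVar_mem_primeIdealOf hi), h (yVar_mem_primeIdealOf hi)⟩,
      fun i j hij => h (minor_mem_primeIdealOf hij)⟩
  · rintro ⟨hvar, hminor⟩
    refine sup_le (Ideal.span_le.2 (Set.iUnion₂_subset ?_)) (iSup_le fun C => Ideal.span_le.2 ?_)
    · rintro i hi _ (rfl | rfl)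
      exacts [(hvar i hi).1, (hvar i hi).2]
    · rintro _ ⟨_, _, ⟨⟨i, hi, rfl⟩, ⟨j, hj, rfl⟩, -⟩, rfl⟩
      exact hminor i j (ConnectedComponent.exact (hi.trans hj.symm))

open Classical in
/-- The directions of the columns of a generic point of the variety of `P_T(G)`: the columns in `T`
vanish, and those in one connected component of the complement share a direction, whose index is a
representative vertex of the component. -/
noncomputable def directions (G : SimpleGraph V) (T : Finset V) (i : V) : Direction V :=
  if h : i ∈ T then zero
  else generic ((G.induce (T : Set V)ᶜ).connectedComponentMk ⟨i, h⟩).out.1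

theorem directions_of_mem {i : V} (hi : i ∈ T) : directions G T i = zero := dif_pos hi

theorem directions_of_notMem (i : ((T : Set V)ᶜ : Set V)) :
    directions G T i = generic ((G.induce (T : Set V)ᶜ).connectedComponentMk i).out.1 :=
  dif_neg i.2

theorem directions_eq_zero_iff {i : V} : directions G T i = zero ↔ i ∈ T := by
  unfold directions
  split <;> simp_all

theorem representative_injective :
    Function.Injective fun C : (G.induce (T : Set V)ᶜ).ConnectedComponent => C.out.1 :=
  Subtype.val_injective.comp fun C D h => by rw [← Quot.out_eq C, h, Quot.out_eq D]

theorem directions_eq_iff {i j : ((T : Set V)ᶜ : Set V)} :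
    directions G T i = directions G T j ↔ (G.induce (T : Set V)ᶜ).Reachable i j := by
  rw [directions_of_notMem, directions_of_notMem, generic.injEq,
    representative_injective.eq_iff, ConnectedComponent.eq]

theorem zeroLocus_primeIdealOf (G : SimpleGraph V) (T : Finset V) :
    zeroLocus (G.primeIdealOf K T : Set (EdgeRing V K)) =
      zeroLocus (columnPrime K (directions G T) : Set (EdgeRing V K)) := by
  refine Set.Subset.antisymm (fun Q hQ => ?_) (zeroLocus_anti_mono ?_)
  · obtain ⟨hvar, hminor⟩ := primeIdealOf_le_iff.1 hQ
    refine columnPrime_le (fun i hi => (hvar i (directions_eq_zero_iff.1 hi)).1)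
      (fun i hi => (hvar i ?_).2) fun i j k hi hj => ?_
    · by_contra hiT
      exact hi _ (directions_of_notMem ⟨i, hiT⟩)
    · have hiT : i ∉ T := fun hiT => by simp [directions_of_mem hiT] at hi
      have hjT : j ∉ T := fun hjT => by simp [directions_of_mem hjT] at hj
      exact hminor ⟨i, hiT⟩ ⟨j, hjT⟩ (directions_eq_iff.1 (hi.trans hj.symm))
  · refine primeIdealOf_le_iff.2 ⟨fun i hi => ?_, fun i j hij => ?_⟩
    · exact ⟨xVar_mem_columnPrime.2 (directions_of_mem hi),
        yVar_mem_columnPrime.2 (by simp [directions_of_mem hi])⟩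
    · exact minor_mem_columnPrime (directions_eq_iff.2 hij)

/-- The number `c_G(T)` of connected components that remain after deleting the vertices in `T`. -/
noncomputable def numComponents (G : SimpleGraph V) (T : Finset V) : ℕ :=
  Nat.card (G.induce (T : Set V)ᶜ).ConnectedComponent

section Finite

variable [Finite V]

theorem ncard_compl_add_card (T : Finset V) : ((T : Set V)ᶜ).ncard + T.card = Nat.card V := by
  rw [← Set.ncard_coe_finset, add_comm, Set.ncard_add_ncard_compl]

theorem card_mul_card_sub_card_add (T : Finset V) (n : ℕ) :
    n * (Nat.card V - T.card) + T.card * n = Nat.card V * n := by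
  rw [← ncard_compl_add_card T, Nat.add_sub_cancel]
  ring

theorem numComponents_add_card_le (G : SimpleGraph V) (T : Finset V) :
    numComponents G T + T.card ≤ Nat.card V := by
  have := Nat.card_le_card_of_surjective (G.induce (T : Set V)ᶜ).connectedComponentMk
    Quot.mk_surjective
  rw [Nat.card_coe_set_eq] at this
  rw [← ncard_compl_add_card T]
  exact Nat.add_le_add_right this _

theorem sum_numComponents_add_sum_card_le {ι : Type*} (G : SimpleGraph V) (s : Finset ι)
    (T : ι → Finset V) :
    ∑ i ∈ s, numComponents G (T i) + ∑ i ∈ s, (T i).card ≤ s.card * Nat.card V := by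
  rw [← Finset.sum_add_distrib, ← smul_eq_mul]
  exact Finset.sum_le_card_nsmul s _ _ fun i _ => numComponents_add_card_le G (T i)

theorem columnDim_directions (G : SimpleGraph V) (T : Finset V) :
    columnDim (directions G T) = Nat.card V - T.card + numComponents G T := by
  have hsupport : {i | directions G T i ≠ zero} = (T : Set V)ᶜ := by
    ext i
    simp [directions_eq_zero_iff]
  have hgeneric : generic ⁻¹' Set.range (directions G T) =
      Set.range fun C : (G.induce (T : Set V)ᶜ).ConnectedComponent => C.out.1 := by
    ext k
    constructor
    · rintro ⟨i, hi⟩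
      have hiT : i ∉ T := fun hiT => by simp [directions_of_mem hiT] at hi
      rw [directions_of_notMem ⟨i, hiT⟩, generic.injEq] at hi
      exact ⟨_, hi⟩
    · rintro ⟨C, rfl⟩
      obtain ⟨i, rfl⟩ := C.exists_rep
      exact ⟨i, directions_of_notMem i⟩
  rw [columnDim, hsupport, hgeneric, ← Nat.card_coe_set_eq (Set.range _),
    Nat.card_range_of_injective representative_injective, numComponents, ← ncard_compl_add_card T,
    Nat.add_sub_cancel]

theorem height_primeIdealOf (G : SimpleGraph V) (T : Finset V) :
    (G.primeIdealOf K T).height = (Nat.card V + T.card - numComponents G T : ℕ) := by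
  have hlocus := zeroLocus_primeIdealOf (K := K) G T
  have hcard := numComponents_add_card_le G T
  rw [(height_le_height_of_zeroLocus_subset hlocus.ge).antisymm
      (height_le_height_of_zeroLocus_subset hlocus.le),
    (height_and_ringKrullDim_columnPrime _).1, columnDim_directions]
  congr 1
  omega

theorem ringKrullDim_quotient_primeIdealOf (G : SimpleGraph V) (T : Finset V) :
    ringKrullDim (EdgeRing V K ⧸ G.primeIdealOf K T) =
      (Nat.card V - T.card + numComponents G T : ℕ) := by
  have hlocus := zeroLocus_primeIdealOf (K := K) G T
  rw [(ringKrullDim_quotient_le_of_zeroLocus_subset hlocus.le).antisymm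
      (ringKrullDim_quotient_le_of_zeroLocus_subset hlocus.ge),
    (height_and_ringKrullDim_columnPrime _).2, columnDim_directions]

end Finite

end PrimeIdealOf

section CutPoints

open SimpleGraph

variable {V : Type*}

/-- The vertex `v` has neighbors in two different connected components of the subgraph of `G`
induced on `S`. For `v ∉ S` this says that `v` is a cut point of the subgraph induced on
`S ∪ {v}`. -/
def JoinsComponents (G : SimpleGraph V) (S : Set V) (v : V) : Prop :=
  ∃ a b : S, G.Adj v a ∧ G.Adj v b ∧ ¬ (G.induce S).Reachable a b

variable {G : SimpleGraph V} {S : Set V} {v : V}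

theorem reachable_induce_of_not_joinsComponents (hv : ¬ JoinsComponents G S v) {S' : Set V}
    (hS' : S' ⊆ S ∪ {v}) {a b : V} (ha : a ∈ S) (hb : b ∈ S) {ha' : a ∈ S'} {hb' : b ∈ S'}
    (h : (G.induce S').Reachable ⟨a, ha'⟩ ⟨b, hb'⟩) :
    (G.induce S).Reachable ⟨a, ha⟩ ⟨b, hb⟩ := by
  simp only [JoinsComponents, not_exists, not_and, not_not] at hv
  -- Follow the path from `a`; at `v` itself the claim becomes one about the neighbors of `v`.
  suffices H : ∀ w : S', (G.induce S').Reachable ⟨a, ha'⟩ w →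
      (∀ hw : w.1 ∈ S, (G.induce S).Reachable ⟨a, ha⟩ ⟨w, hw⟩) ∧
        (w.1 = v → ∀ c : S, G.Adj v c → (G.induce S).Reachable ⟨a, ha⟩ c) from (H _ h).1 hb
  intro w haw
  rw [reachable_iff_reflTransGen] at haw
  induction haw with
  | refl => exact ⟨fun _ => Reachable.refl _, fun hav c hc => Adj.reachable (hav.symm ▸ hc :)⟩
  | @tail x y _ hxy ih =>
    rw [comap_adj] at hxy
    by_cases hx : x.1 = v
    · exact ⟨fun hy => ih.2 hx ⟨y, hy⟩ (hx ▸ hxy), fun hy => absurd (hx.trans hy.symm) hxy.ne⟩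
    · have hxS : x.1 ∈ S := (hS' x.2).resolve_right hx
      refine ⟨fun hy => (ih.1 hxS).trans (Adj.reachable hxy), fun hy c hc => ?_⟩
      exact (ih.1 hxS).trans (hv ⟨x, hxS⟩ c (hy ▸ hxy.symm) hc)

/-- Deleting the vertex `v` from the subgraph induced on `S ∪ {v}`. -/
def induceUnionInduceIso (G : SimpleGraph V) (hv : v ∉ S) :
    (G.induce (S ∪ {v})).induce ({⟨v, Or.inr rfl⟩}ᶜ : Set _) ≃g G.induce S where
  toFun x := ⟨x.1.1, x.1.2.resolve_right fun h => x.2 (Subtype.ext h)⟩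
  invFun x := ⟨⟨x.1, Or.inl x.2⟩, fun h => hv ((congrArg (fun y => y.1) h : x.1 = v) ▸ x.2)⟩
  left_inv _ := rfl
  right_inv _ := rfl
  map_rel_iff' := Iff.rfl

variable [Finite V]

theorem isCutPoint_induce_iff (hv : v ∉ S) :
    (G.induce (S ∪ {v})).IsCutPoint ⟨v, Or.inr rfl⟩ ↔ JoinsComponents G S v := by
  let f : (G.induce S).ConnectedComponent → (G.induce (S ∪ {v})).ConnectedComponent :=
    ConnectedComponent.map (induceHomOfLE G Set.subset_union_left).toHom
  rw [IsCutPoint, Nat.card_congr (induceUnionInduceIso G hv).connectedComponentEquiv]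
  constructor
  · refine fun hcut => by_contra fun hjoin => hcut.not_ge ?_
    refine Nat.card_le_card_of_injective f fun C D hCD => ?_
    induction C, D using ConnectedComponent.ind₂ with
    | h a b =>
      exact ConnectedComponent.sound (reachable_induce_of_not_joinsComponents hjoin subset_rfl
        a.2 b.2 (ConnectedComponent.exact hCD))
  · rintro ⟨a, b, ha, hb, hab⟩
    have hva : (G.induce (S ∪ {v})).Adj ⟨v, Or.inr rfl⟩ ⟨a, Or.inl a.2⟩ := ha
    have hvb : (G.induce (S ∪ {v})).Adj ⟨v, Or.inr rfl⟩ ⟨b, Or.inl b.2⟩ := hb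
    have hfab : f (connectedComponentMk _ a) = f (connectedComponentMk _ b) :=
      ConnectedComponent.sound (hva.symm.reachable.trans hvb.reachable)
    have hsurj : Function.Surjective f := fun C => by
      induction C using ConnectedComponent.ind with
      | h w =>
        obtain ⟨w, hw | rfl⟩ := w
        · exact ⟨connectedComponentMk _ ⟨w, hw⟩, rfl⟩
        · exact ⟨connectedComponentMk _ a, ConnectedComponent.sound hva.symm.reachable⟩
    refine (Nat.card_le_card_of_surjective f hsurj).lt_of_ne fun hcard => hab ?_
    have hbij := (Nat.bijective_iff_surjective_and_card f).2 ⟨hsurj, hcard.symm⟩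
    exact ConnectedComponent.exact (hbij.injective hfab)

theorem mem_cutPointSets_iff {T : Finset V} :
    T ∈ G.cutPointSets ↔ ∀ i ∈ T, JoinsComponents G (T : Set V)ᶜ i := by
  have hiff : G.HasCutPointProperty T ↔ ∀ i ∈ T, JoinsComponents G (T : Set V)ᶜ i :=
    forall₂_congr fun i hi => isCutPoint_induce_iff fun h => h hi
  rw [← hiff]
  refine ⟨?_, Or.inr⟩
  rintro (rfl | hT)
  · simp [HasCutPointProperty]
  · exact hT

end CutPoints

section BinomialEdgeIdeal

open SimpleGraph

variable {V K : Type*} [Field K] {G : SimpleGraph V}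

theorem binomialEdgeIdeal_le_primeIdealOf (G : SimpleGraph V) (T : Finset V) :
    G.binomialEdgeIdeal K ≤ G.primeIdealOf K T := by
  refine Ideal.span_le.2 ?_
  rintro _ ⟨i, j, hij, rfl⟩
  change minor K i j ∈ _
  by_cases hi : i ∈ T
  · exact (minor_mem_of_xVar_mem_of_yVar_mem j (xVar_mem_primeIdealOf hi)
      (yVar_mem_primeIdealOf hi)).1
  by_cases hj : j ∈ T
  · exact (minor_mem_of_xVar_mem_of_yVar_mem i (xVar_mem_primeIdealOf hj)
      (yVar_mem_primeIdealOf hj)).2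
  · exact minor_mem_primeIdealOf (i := ⟨i, hi⟩) (j := ⟨j, hj⟩) (Adj.reachable hij)

theorem minor_mem_trans {Q : Ideal (EdgeRing V K)} [hQ : Q.IsPrime] {i j k : V}
    (hj : ¬ (xVar K j ∈ Q ∧ yVar K j ∈ Q)) (hij : minor K i j ∈ Q) (hjk : minor K j k ∈ Q) :
    minor K i k ∈ Q := by
  have hx : xVar K j * minor K i k ∈ Q := by
    convert Q.add_mem (Q.mul_mem_left (xVar K i) hjk) (Q.mul_mem_left (xVar K k) hij) using 1
    simp only [minor]
    ring
  have hy : yVar K j * minor K i k ∈ Q := by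
    convert Q.add_mem (Q.mul_mem_left (yVar K i) hjk) (Q.mul_mem_left (yVar K k) hij) using 1
    simp only [minor]
    ring
  by_contra hik
  exact hj ⟨(hQ.mem_or_mem hx).resolve_right hik, (hQ.mem_or_mem hy).resolve_right hik⟩

theorem primeIdealOf_erase_le [DecidableEq V] {T : Finset V} {i : V}
    (h : ¬ JoinsComponents G (T : Set V)ᶜ i) :
    G.primeIdealOf K (T.erase i) ≤ G.primeIdealOf K T := by
  have hvar {j : V} (hj : j ∈ T) : xVar K j ∈ G.primeIdealOf K T ∧ yVar K j ∈ G.primeIdealOf K T :=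
    ⟨xVar_mem_primeIdealOf hj, yVar_mem_primeIdealOf hj⟩
  refine primeIdealOf_le_iff.2 ⟨fun j hj => hvar (Finset.mem_of_mem_erase hj), fun j k hjk => ?_⟩
  by_cases hj : j.1 ∈ T
  · exact (minor_mem_of_xVar_mem_of_yVar_mem k.1 (hvar hj).1 (hvar hj).2).1
  by_cases hk : k.1 ∈ T
  · exact (minor_mem_of_xVar_mem_of_yVar_mem j.1 (hvar hk).1 (hvar hk).2).2
  have hsubset : ((T.erase i : Finset V) : Set V)ᶜ ⊆ (T : Set V)ᶜ ∪ {i} := fun l hl => by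
    by_cases hli : l = i
    · exact Or.inr hli
    · exact Or.inl fun hlT => hl (Finset.mem_erase.2 ⟨hli, hlT⟩)
  have hj' : j.1 ∈ (T : Set V)ᶜ := hj
  have hk' : k.1 ∈ (T : Set V)ᶜ := hk
  have hreach := reachable_induce_of_not_joinsComponents h hsubset hj' hk' hjk
  exact minor_mem_primeIdealOf (i := ⟨j.1, hj'⟩) (j := ⟨k.1, hk'⟩) hreach

variable [Finite V]

theorem exists_primeIdealOf_le {Q : Ideal (EdgeRing V K)} [Q.IsPrime]
    (h : G.binomialEdgeIdeal K ≤ Q) : ∃ T, G.primeIdealOf K T ≤ Q := by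
  let T : Finset V := (Set.toFinite {i | xVar K i ∈ Q ∧ yVar K i ∈ Q}).toFinset
  have hT (i : V) : i ∈ T ↔ xVar K i ∈ Q ∧ yVar K i ∈ Q := by simp [T]
  refine ⟨T, primeIdealOf_le_iff.2 ⟨fun i => (hT i).1, fun i j hij => ?_⟩⟩
  rw [reachable_iff_reflTransGen] at hij
  induction hij with
  | refl => simp [minor]
  | @tail j k _ hjk ih =>
    exact minor_mem_trans ((hT j).not.1 j.2) ih (h (Ideal.subset_span ⟨j, k, hjk, rfl⟩))

theorem exists_mem_cutPointSets_primeIdealOf_le {Q : Ideal (EdgeRing V K)} [Q.IsPrime]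
    (h : G.binomialEdgeIdeal K ≤ Q) : ∃ T ∈ G.cutPointSets, G.primeIdealOf K T ≤ Q := by
  classical
  obtain ⟨T, hT⟩ := exists_minimal_of_wellFoundedLT _ (exists_primeIdealOf_le h)
  refine ⟨T, mem_cutPointSets_iff.2 fun i hi => by_contra fun hjoin => ?_, hT.prop⟩
  exact hT.not_prop_of_lt (Finset.erase_ssubset hi) ((primeIdealOf_erase_le hjoin).trans hT.prop)

theorem zeroLocus_binomialEdgeIdeal (G : SimpleGraph V) :
    zeroLocus (G.binomialEdgeIdeal K : Set (EdgeRing V K)) =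
      ⋃ T ∈ G.cutPointSets, zeroLocus (G.primeIdealOf K T : Set (EdgeRing V K)) := by
  refine Set.Subset.antisymm (fun Q hQ => ?_) (Set.iUnion₂_subset fun T _ => ?_)
  · obtain ⟨T, hT, hTQ⟩ := exists_mem_cutPointSets_primeIdealOf_le hQ
    exact Set.mem_iUnion₂.2 ⟨T, hT, hTQ⟩
  · exact zeroLocus_anti_mono (binomialEdgeIdeal_le_primeIdealOf G T)

theorem isLeast_height_binomialEdgeIdeal (G : SimpleGraph V) :
    IsLeast ((fun T => (G.primeIdealOf K T).height) '' G.cutPointSets)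
      (G.binomialEdgeIdeal K).height :=
  isLeast_height_of_zeroLocus_eq_biUnion ⟨∅, Or.inl rfl⟩ (zeroLocus_binomialEdgeIdeal G)

theorem isGreatest_ringKrullDim_binomialEdgeIdeal (G : SimpleGraph V) :
    IsGreatest ((fun T => ringKrullDim (EdgeRing V K ⧸ G.primeIdealOf K T)) '' G.cutPointSets)
      (ringKrullDim (EdgeRing V K ⧸ G.binomialEdgeIdeal K)) :=
  isGreatest_ringKrullDim_of_zeroLocus_eq_biUnion ⟨∅, Or.inl rfl⟩ (Set.toFinite _)
    (zeroLocus_binomialEdgeIdeal G)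

end BinomialEdgeIdeal

section Corona

open SimpleGraph

theorem inl_mem_of_joinsComponents_inr {V W : Type*} {H : SimpleGraph V} {H' : SimpleGraph W}
    {T' : Finset (V ⊕ V × W)} {v : V} {a : W}
    (h : JoinsComponents (H.corona H') (T' : Set (V ⊕ V × W))ᶜ (Sum.inr (v, a))) :
    Sum.inl v ∈ T' := by
  by_contra hv
  have hreach (p : ((T' : Set (V ⊕ V × W))ᶜ : Set (V ⊕ V × W)))
      (hp : (H.corona H').Adj (Sum.inr (v, a)) p) :
      ((H.corona H').induce (T' : Set (V ⊕ V × W))ᶜ).Reachable p ⟨Sum.inl v, hv⟩ := by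
    obtain ⟨s | ⟨s, b⟩, hs⟩ := p
    · obtain rfl : v = s := hp
      exact Reachable.refl _
    · obtain ⟨rfl : v = s, -⟩ := hp
      exact Adj.reachable (show (H.corona H').Adj (Sum.inr (v, b)) (Sum.inl v) from rfl)
  obtain ⟨p, q, hp, hq, hpq⟩ := h
  exact hpq ((hreach p hp).trans (hreach q hq).symm)

variable {V W : Type*} [DecidableEq V] [DecidableEq W]

@[simp] theorem inl_mem_coronaSet {T : Finset V} {Tv : V → Finset W} {s : V} :
    Sum.inl s ∈ coronaSet T Tv ↔ s ∈ T := by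
  simp [coronaSet]

@[simp] theorem inr_mem_coronaSet {T : Finset V} {Tv : V → Finset W} {q : V × W} :
    Sum.inr q ∈ coronaSet T Tv ↔ q.1 ∈ T ∧ q.2 ∈ Tv q.1 := by
  obtain ⟨s, a⟩ := q
  simp [coronaSet]

theorem card_coronaSet (T : Finset V) (Tv : V → Finset W) :
    (coronaSet T Tv).card = T.card + ∑ v ∈ T, (Tv v).card := by
  have h : coronaSet T Tv =
      T.disjSum ((T.sigma Tv).map (Equiv.sigmaEquivProd V W).toEmbedding) := by
    ext (s | ⟨s, a⟩) <;> simp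
  rw [h, Finset.card_disjSum, Finset.card_map, Finset.card_sigma]

section Components

variable (H : SimpleGraph V) (H' : SimpleGraph W) (T : Finset V) (Tv : V → Finset W)

/-- The subgraph of the corona that remains after deleting `coronaSet T Tv`. -/
abbrev coronaRemainder : SimpleGraph ((coronaSet T Tv : Set (V ⊕ V × W))ᶜ : Set (V ⊕ V × W)) :=
  (H.corona H').induce (coronaSet T Tv : Set (V ⊕ V × W))ᶜ

/-- The connected components of `H - T` and of the copies `H'_v - T_v`, `v ∈ T`. -/
abbrev CoronaComponents : Type _ :=
  (H.induce (T : Set V)ᶜ).ConnectedComponent ⊕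
    (Σ v : T, (H'.induce (Tv v : Set W)ᶜ).ConnectedComponent)

/-- The component of `H - T` or of a copy `H'_v - T_v`, `v ∈ T`, to which a vertex of the corona
belongs. A copy `H'_v` with `v ∉ T` is attached to the component of `v`. -/
def coronaComponent :
    ((coronaSet T Tv : Set (V ⊕ V × W))ᶜ : Set (V ⊕ V × W)) → CoronaComponents H H' T Tv
  | ⟨Sum.inl s, hs⟩ => Sum.inl (connectedComponentMk _ ⟨s, fun h => hs (inl_mem_coronaSet.2 h)⟩)
  | ⟨Sum.inr q, hq⟩ =>
    if h : q.1 ∈ T then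
      Sum.inr ⟨⟨q.1, h⟩, connectedComponentMk _ ⟨q.2, fun ha => hq (inr_mem_coronaSet.2 ⟨h, ha⟩)⟩⟩
    else Sum.inl (connectedComponentMk _ ⟨q.1, h⟩)

/-- The inclusion of `H - T` in the corona. -/
def coronaBaseHom : H.induce (T : Set V)ᶜ →g coronaRemainder H H' T Tv where
  toFun s := ⟨Sum.inl s.1, fun h => s.2 (inl_mem_coronaSet.1 h)⟩
  map_rel' h := h

/-- The inclusion of the copy `H'_v - T_v` in the corona. -/
def coronaCopyHom (v : V) : H'.induce (Tv v : Set W)ᶜ →g coronaRemainder H H' T Tv where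
  toFun a := ⟨Sum.inr (v, a.1), fun h => a.2 (inr_mem_coronaSet.1 h).2⟩
  map_rel' h := ⟨rfl, h⟩

variable {H H' T Tv}

theorem coronaComponent_coronaCopyHom (v : T) (a : ((Tv v : Set W)ᶜ : Set W)) :
    coronaComponent H H' T Tv (coronaCopyHom H H' T Tv v a) =
      Sum.inr ⟨v, connectedComponentMk _ a⟩ :=
  dif_pos v.2

theorem coronaComponent_eq_of_adj {p q : ((coronaSet T Tv : Set (V ⊕ V × W))ᶜ : Set (V ⊕ V × W))}
    (h : (coronaRemainder H H' T Tv).Adj p q) :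
    coronaComponent H H' T Tv p = coronaComponent H H' T Tv q := by
  obtain ⟨s | ⟨s, a⟩, hp⟩ := p <;> obtain ⟨t | ⟨t, b⟩, hq⟩ := q
  · exact congrArg Sum.inl (ConnectedComponent.sound (Adj.reachable h))
  · obtain rfl : s = t := h
    have hs : s ∉ T := fun h => hp (inl_mem_coronaSet.2 h)
    simp [coronaComponent, hs]
  · obtain rfl : s = t := h
    have hs : s ∉ T := fun h => hq (inl_mem_coronaSet.2 h)
    simp [coronaComponent, hs]
  · obtain ⟨rfl : s = t, hab⟩ := h
    by_cases hs : s ∈ T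
    · simp only [coronaComponent, hs, dif_pos]
      congr 2
      exact ConnectedComponent.sound (Adj.reachable hab)
    · simp [coronaComponent, hs]

variable (H H' T Tv)

/-- Deleting `coronaSet T Tv` from the corona leaves the components of `H - T`, together with the
copies of `H'` attached to them, and the components of `H'_v - T_v` for `v ∈ T`. -/
def coronaComponentEquiv :
    (coronaRemainder H H' T Tv).ConnectedComponent ≃ CoronaComponents H H' T Tv where
  toFun := Quot.lift (coronaComponent H H' T Tv) fun p q h => by
    rw [reachable_iff_reflTransGen] at h
    induction h with
    | refl => rfl
    | tail _ h ih => exact ih.trans (coronaComponent_eq_of_adj h)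
  invFun := Sum.elim (ConnectedComponent.map (coronaBaseHom H H' T Tv))
    fun x => ConnectedComponent.map (coronaCopyHom H H' T Tv x.1) x.2
  left_inv := by
    refine ConnectedComponent.ind fun p => ?_
    obtain ⟨s | ⟨s, a⟩, hp⟩ := p
    · rfl
    · change Sum.elim _ _ (coronaComponent H H' T Tv _) = _
      by_cases hs : s ∈ T
      · simp only [coronaComponent, hs, dif_pos]
        rfl
      · simp only [coronaComponent, hs]
        exact ConnectedComponent.sound (Adj.reachable rfl)
  right_inv := by
    rintro (C | ⟨v, C⟩)
    · induction C using ConnectedComponent.ind with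
      | h s => rfl
    · induction C using ConnectedComponent.ind with
      | h a => exact coronaComponent_coronaCopyHom v a

variable {H H' T Tv}

theorem reachable_coronaRemainder_iff
    {p q : ((coronaSet T Tv : Set (V ⊕ V × W))ᶜ : Set (V ⊕ V × W))} :
    (coronaRemainder H H' T Tv).Reachable p q ↔
      coronaComponent H H' T Tv p = coronaComponent H H' T Tv q := by
  rw [← ConnectedComponent.eq, ← (coronaComponentEquiv H H' T Tv).apply_eq_iff_eq]
  rfl

theorem reachable_coronaCopyHom_iff {v : V} (hv : v ∈ T) {a b : ((Tv v : Set W)ᶜ : Set W)} :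
    (coronaRemainder H H' T Tv).Reachable
        (coronaCopyHom H H' T Tv v a) (coronaCopyHom H H' T Tv v b) ↔
      (H'.induce (Tv v : Set W)ᶜ).Reachable a b := by
  rw [reachable_coronaRemainder_iff, coronaComponent_coronaCopyHom ⟨v, hv⟩ a,
    coronaComponent_coronaCopyHom ⟨v, hv⟩ b]
  simp

theorem not_reachable_coronaBaseHom_coronaCopyHom {v : V} (hv : v ∈ T)
    (s : ((T : Set V)ᶜ : Set V)) (a : ((Tv v : Set W)ᶜ : Set W)) :
    ¬ (coronaRemainder H H' T Tv).Reachable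
      (coronaBaseHom H H' T Tv s) (coronaCopyHom H H' T Tv v a) := by
  rw [reachable_coronaRemainder_iff, coronaComponent_coronaCopyHom ⟨v, hv⟩ a]
  exact Sum.inl_ne_inr

end Components

section CutPointSets

variable {H : SimpleGraph V} {H' : SimpleGraph W} {T : Finset V} {Tv : V → Finset W} {v : V}

theorem joinsComponents_inr_iff (hv : v ∈ T) {a : W} :
    JoinsComponents (H.corona H') (coronaSet T Tv : Set (V ⊕ V × W))ᶜ (Sum.inr (v, a)) ↔
      JoinsComponents H' (Tv v : Set W)ᶜ a := by
  constructor
  · rintro ⟨⟨p, hp⟩, ⟨q, hq⟩, hap, haq, hpq⟩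
    rcases p with s | ⟨s, b⟩
    · obtain rfl : v = s := hap
      exact (hp (inl_mem_coronaSet.2 hv)).elim
    rcases q with t | ⟨t, c⟩
    · obtain rfl : v = t := haq
      exact (hq (inl_mem_coronaSet.2 hv)).elim
    obtain ⟨rfl : v = s, hab⟩ := hap
    obtain ⟨rfl : v = t, hac⟩ := haq
    exact ⟨⟨b, fun hb => hp (inr_mem_coronaSet.2 ⟨hv, hb⟩)⟩,
      ⟨c, fun hc => hq (inr_mem_coronaSet.2 ⟨hv, hc⟩)⟩, hab, hac,
      fun hbc => hpq ((reachable_coronaCopyHom_iff hv).2 hbc)⟩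
  · rintro ⟨b, c, hab, hac, hbc⟩
    exact ⟨coronaCopyHom H H' T Tv v b, coronaCopyHom H H' T Tv v c, ⟨rfl, hab⟩, ⟨rfl, hac⟩,
      fun h => hbc ((reachable_coronaCopyHom_iff hv).1 h)⟩

theorem joinsComponents_inl [Nonempty W] (hv : v ∈ T)
    (hTv : ∀ a ∈ Tv v, JoinsComponents H' (Tv v : Set W)ᶜ a)
    (h : H.neighborSet v ⊆ (T : Set V) → Tv v ≠ ∅) :
    JoinsComponents (H.corona H') (coronaSet T Tv : Set (V ⊕ V × W))ᶜ (Sum.inl v) := by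
  rcases (Tv v).eq_empty_or_nonempty with hempty | ⟨a, ha⟩
  · obtain ⟨s, hs, hsT⟩ := Set.not_subset.1 fun hN => h hN hempty
    obtain ⟨a⟩ := ‹Nonempty W›
    exact ⟨coronaBaseHom H H' T Tv ⟨s, hsT⟩, coronaCopyHom H H' T Tv v ⟨a, by simp [hempty]⟩,
      hs, rfl, not_reachable_coronaBaseHom_coronaCopyHom hv _ _⟩
  · obtain ⟨b, c, -, -, hbc⟩ := hTv a ha
    exact ⟨coronaCopyHom H H' T Tv v b, coronaCopyHom H H' T Tv v c, rfl, rfl,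
      fun h => hbc ((reachable_coronaCopyHom_iff hv).1 h)⟩

theorem nonempty_of_joinsComponents_inl (hH' : H'.Preconnected) (hv : v ∈ T)
    (h : JoinsComponents (H.corona H') (coronaSet T Tv : Set (V ⊕ V × W))ᶜ (Sum.inl v))
    (hN : H.neighborSet v ⊆ (T : Set V)) : Tv v ≠ ∅ := by
  intro hempty
  obtain ⟨⟨p, hp⟩, ⟨q, hq⟩, hvp, hvq, hpq⟩ := h
  rcases p with s | ⟨s, b⟩
  · exact hp (inl_mem_coronaSet.2 (hN hvp))
  rcases q with t | ⟨t, c⟩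
  · exact hq (inl_mem_coronaSet.2 (hN hvq))
  obtain rfl : v = s := hvp
  obtain rfl : v = t := hvq
  have hcopy : (H'.induce (Tv v : Set W)ᶜ).Preconnected := by
    rw [hempty, Finset.coe_empty, Set.compl_empty]
    exact (induceUnivIso H').preconnected_iff.2 hH'
  exact hpq ((reachable_coronaCopyHom_iff hv (a := ⟨b, by simp [hempty]⟩)
    (b := ⟨c, by simp [hempty]⟩)).2 (hcopy _ _))

theorem coronaSet_empty (Tv : V → Finset W) : coronaSet ∅ Tv = ∅ := by
  simp [coronaSet]

variable [Finite V] [Finite W]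

theorem coronaSet_mem_cutPointSets_iff (hH' : H'.Connected) (hT : T.Nonempty) :
    coronaSet T Tv ∈ (H.corona H').cutPointSets ↔ CoronaProperty H H' T Tv := by
  simp only [CoronaProperty, hT, true_and, mem_cutPointSets_iff]
  constructor
  · exact fun h v hv =>
      ⟨fun a ha => (joinsComponents_inr_iff hv).1 (h _ (inr_mem_coronaSet.2 ⟨hv, ha⟩)),
        nonempty_of_joinsComponents_inl hH'.preconnected hv (h _ (inl_mem_coronaSet.2 hv))⟩
  · rintro h (v | ⟨v, a⟩) hi
    · have := hH'.nonempty
      have hv := inl_mem_coronaSet.1 hi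
      exact joinsComponents_inl hv (h v hv).1 (h v hv).2
    · obtain ⟨hv, ha⟩ := inr_mem_coronaSet.1 hi
      exact (joinsComponents_inr_iff hv).2 ((h v hv).1 a ha)

theorem exists_eq_coronaSet {T' : Finset (V ⊕ V × W)} (h : T' ∈ (H.corona H').cutPointSets) :
    ∃ T Tv, T' = coronaSet T Tv := by
  have := Fintype.ofFinite V
  have := Fintype.ofFinite W
  refine ⟨({v | Sum.inl v ∈ T'} : Finset V), fun v => ({a | Sum.inr (v, a) ∈ T'} : Finset W), ?_⟩
  ext (v | ⟨v, a⟩)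
  · simp
  · simpa using fun ha => inl_mem_of_joinsComponents_inr (mem_cutPointSets_iff.1 h _ ha)

theorem cutPointSets_corona (hH' : H'.Connected) :
    (H.corona H').cutPointSets = {∅} ∪ {T' | ∃ (T : Finset V) (Tv : V → Finset W),
      CoronaProperty H H' T Tv ∧ T' = coronaSet T Tv} := by
  ext T'
  constructor
  · intro h
    obtain ⟨T, Tv, rfl⟩ := exists_eq_coronaSet h
    obtain rfl | hT := T.eq_empty_or_nonempty
    · exact Or.inl (coronaSet_empty Tv)
    · exact Or.inr ⟨T, Tv, (coronaSet_mem_cutPointSets_iff hH' hT).1 h, rfl⟩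
  · rintro (rfl | ⟨T, Tv, h, rfl⟩)
    · exact Or.inl rfl
    · exact (coronaSet_mem_cutPointSets_iff hH' h.1).2 h

theorem image_cutPointSets_corona {α : Type*} (hH' : H'.Connected)
    (f : Finset (V ⊕ V × W) → α) :
    f '' (H.corona H').cutPointSets = {x | ∃ (T : Finset V) (Tv : V → Finset W),
      CoronaProperty H H' T Tv ∧ x = f (coronaSet T Tv)} ∪ {f ∅} := by
  rw [cutPointSets_corona hH', Set.image_union, Set.image_singleton, Set.union_comm]
  congr 1
  ext x
  constructor
  · rintro ⟨_, ⟨T, Tv, h, rfl⟩, rfl⟩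
    exact ⟨T, Tv, h, rfl⟩
  · rintro ⟨T, Tv, h, rfl⟩
    exact ⟨_, ⟨T, Tv, h, rfl⟩, rfl⟩

end CutPointSets

section HeightAndDimension

variable {K : Type*} [Field K] [Finite V] [Finite W]

theorem numComponents_corona (H : SimpleGraph V) (H' : SimpleGraph W) (T : Finset V)
    (Tv : V → Finset W) : numComponents (H.corona H') (coronaSet T Tv) =
      numComponents H T + ∑ v ∈ T, numComponents H' (Tv v) := by
  rw [numComponents, Nat.card_congr (coronaComponentEquiv H H' T Tv), Nat.card_sum, Nat.card_sigma,
    Finset.sum_coe_sort T fun v => Nat.card (H'.induce (Tv v : Set W)ᶜ).ConnectedComponent]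
  rfl

theorem height_primeIdealOf_coronaSet (H : SimpleGraph V) (H' : SimpleGraph W) (T : Finset V)
    (Tv : V → Finset W) : ((H.corona H').primeIdealOf K (coronaSet T Tv)).height =
      (H.primeIdealOf K T).height + ∑ v ∈ T, (H'.primeIdealOf K (Tv v)).height
        + (Nat.card W * (Nat.card V - T.card) : ℕ) := by
  have hT := numComponents_add_card_le H T
  have hTv := sum_numComponents_add_sum_card_le H' T Tv
  have hcard := card_mul_card_sub_card_add T (Nat.card W)
  have hsum : ∑ v ∈ T, (Nat.card W + (Tv v).card - numComponents H' (Tv v)) =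
      T.card * Nat.card W + ∑ v ∈ T, (Tv v).card - ∑ v ∈ T, numComponents H' (Tv v) := by
    rw [Finset.sum_tsub_distrib _ fun v _ => by have := numComponents_add_card_le H' (Tv v); omega,
      Finset.sum_add_distrib, Finset.sum_const, smul_eq_mul]
  simp only [height_primeIdealOf, numComponents_corona, card_coronaSet, Nat.card_sum, Nat.card_prod]
  norm_cast
  omega

theorem ringKrullDim_quotient_primeIdealOf_coronaSet (H : SimpleGraph V) (H' : SimpleGraph W)
    (T : Finset V) (Tv : V → Finset W) :
    ringKrullDim (EdgeRing (V ⊕ V × W) K ⧸ (H.corona H').primeIdealOf K (coronaSet T Tv)) =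
      ringKrullDim (EdgeRing V K ⧸ H.primeIdealOf K T)
        + ∑ v ∈ T, ringKrullDim (EdgeRing W K ⧸ H'.primeIdealOf K (Tv v))
        + (Nat.card W * (Nat.card V - T.card) : ℕ) := by
  have hT := numComponents_add_card_le H T
  have hTv := sum_numComponents_add_sum_card_le H' T Tv
  have hcard := card_mul_card_sub_card_add T (Nat.card W)
  have hsum : ∑ v ∈ T, (Nat.card W - (Tv v).card + numComponents H' (Tv v)) =
      T.card * Nat.card W - ∑ v ∈ T, (Tv v).card + ∑ v ∈ T, numComponents H' (Tv v) := by
    rw [Finset.sum_add_distrib, Finset.sum_tsub_distrib _ fun v _ => by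
      have := numComponents_add_card_le H' (Tv v); omega, Finset.sum_const, smul_eq_mul]
  simp only [ringKrullDim_quotient_primeIdealOf, numComponents_corona, card_coronaSet,
    Nat.card_sum, Nat.card_prod]
  norm_cast
  omega

end HeightAndDimension

end Corona

section CoronaEmpty

open SimpleGraph

variable {V W K : Type*} [Field K] [Finite V] [Finite W] {H : SimpleGraph V}

theorem numComponents_corona_empty (hH : H.Connected) (H' : SimpleGraph W) :
    numComponents (H.corona H') ∅ = 1 := by
  classical
  have hunique : Nat.card H.ConnectedComponent = 1 :=
    have := hH.preconnected.subsingleton_connectedComponent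
    have := hH.nonempty
    Nat.card_unique
  rw [← coronaSet_empty fun _ => ∅, numComponents_corona, Finset.sum_empty, add_zero, numComponents,
    Finset.coe_empty, Set.compl_empty, Nat.card_congr (induceUnivIso H).connectedComponentEquiv,
    hunique]

theorem height_primeIdealOf_corona_empty (hH : H.Connected) (H' : SimpleGraph W) :
    ((H.corona H').primeIdealOf K ∅).height =
      (Nat.card V + Nat.card V * Nat.card W - 1 : ℕ) := by
  simp [height_primeIdealOf, numComponents_corona_empty hH]

theorem ringKrullDim_quotient_primeIdealOf_corona_empty (hH : H.Connected) (H' : SimpleGraph W) :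
    ringKrullDim (EdgeRing (V ⊕ V × W) K ⧸ (H.corona H').primeIdealOf K ∅) =
      (Nat.card V + Nat.card V * Nat.card W + 1 : ℕ) := by
  simp [ringKrullDim_quotient_primeIdealOf, numComponents_corona_empty hH]

end CoronaEmpty

end BinomialEdge

open SimpleGraph in
theorem proposition5p1 {V W K : Type*} [Fintype V] [DecidableEq V] [Fintype W] [DecidableEq W]
    [Field K] (H : SimpleGraph V) (H' : SimpleGraph W)
    (hH : H.Connected) (hH' : H'.Connected) :
    -- (a)
    (H.corona H').cutPointSets =
        {∅} ∪ {T' | ∃ (T : Finset V) (Tv : V → Finset W),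
          CoronaProperty H H' T Tv ∧ T' = coronaSet T Tv} ∧
    -- (b)
    IsLeast
      ({h : ℕ∞ | ∃ (T : Finset V) (Tv : V → Finset W), CoronaProperty H H' T Tv ∧
          h = (H.primeIdealOf K T).height + ∑ v ∈ T, (H'.primeIdealOf K (Tv v)).height
            + ((Fintype.card W * (Fintype.card V - T.card) : ℕ) : ℕ∞)} ∪
        {((Fintype.card V + Fintype.card V * Fintype.card W - 1 : ℕ) : ℕ∞)})
      ((H.corona H').binomialEdgeIdeal K).height ∧
    -- (c)
    IsGreatest
      ({d : WithBot ℕ∞ | ∃ (T : Finset V) (Tv : V → Finset W), CoronaProperty H H' T Tv ∧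
          d = ringKrullDim (EdgeRing V K ⧸ H.primeIdealOf K T)
            + ∑ v ∈ T, ringKrullDim (EdgeRing W K ⧸ H'.primeIdealOf K (Tv v))
            + ((Fintype.card W * (Fintype.card V - T.card) : ℕ) : WithBot ℕ∞)} ∪
        {((Fintype.card V + Fintype.card V * Fintype.card W + 1 : ℕ) : WithBot ℕ∞)})
      (ringKrullDim (EdgeRing (V ⊕ V × W) K ⧸ (H.corona H').binomialEdgeIdeal K)) := by
  refine ⟨BinomialEdge.cutPointSets_corona hH', ?_, ?_⟩
  · simpa only [BinomialEdge.image_cutPointSets_corona hH',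
      BinomialEdge.height_primeIdealOf_coronaSet, BinomialEdge.height_primeIdealOf_corona_empty hH,
      Nat.card_eq_fintype_card]
      using BinomialEdge.isLeast_height_binomialEdgeIdeal (K := K) (H.corona H')
  · simpa only [BinomialEdge.image_cutPointSets_corona hH',
      BinomialEdge.ringKrullDim_quotient_primeIdealOf_coronaSet,
      BinomialEdge.ringKrullDim_quotient_primeIdealOf_corona_empty hH, Nat.card_eq_fintype_card]
      using BinomialEdge.isGreatest_ringKrullDim_binomialEdgeIdeal (K := K) (H.corona H')
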